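/- Let $\mathcal C$ be a small additive category (a category enriched in abelian groups, with finite biproducts), and let $\operatorname{Fun}(\mathcal C^{op},\mathrm{Ab})$ be the abelian category of additive functors $\mathcal C^{op}\to \mathrm{Ab}$ (right $\mathcal C$-modules). A right $\mathcal C$-module $F$ is finitely generated if there is an epimorphism onto $F$ from a finite direct sum of representable modules $\operatorname{Hom}_{\mathcal C}(-,c)$. It is of type $\mathcal{FP}_n$ ($n\ge 0$) if there is an exact sequence $P_n\to\cdots\to P_1\to P_0\to F\to 0$ with every $P_i$ finitely generated and projective; in particular type $\mathcal{FP}_0$ means finitely generated. For $n\geq 1$, $F$ is $n$-coherent if it is of type $\mathcal{FP}_n$ and every subobject of $F$ of type $\mathcal{FP}_{n-1}$ is of type $\mathcal{FP}_n$. The category $\mathcal C$ is right $n$-coherent if every right $\mathcal C$-module of type $\mathcal{FP}_n$ is $n$-coherent; it is right regular $n$-coherent if, moreover, every right $\mathcal C$-module of type $\mathcal{FP}_n$ has finite projective dimension. A morphism $g:k\to x$ of $\mathcal C$ is a pseudo kernel of $f:x\to y$ if $f\circ g=0$ and every $h:c\to x$ with $f\circ h=0$ is of the form $h=g\circ t$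 for some $t:c\to k$. For $n\ge 0$, a pseudo $n$-kernel of $f:x\to y$ is a chain $x_n\xrightarrow{f_n}\cdots\xrightarrow{f_2}x_1\xrightarrow{f_1}x_0=x$ such that, with $f_0=f$, each $f_{i+1}$ is a pseudo kernel of $f_i$, i.e. $\operatorname{Hom}_{\mathcal C}(-,x_n)\to\cdots\to\operatorname{Hom}_{\mathcal C}(-,x_1)\to\operatorname{Hom}_{\mathcal C}(-,x)\to\operatorname{Hom}_{\mathcal C}(-,y)$ is exact (for $n=0$ there is no condition, so every morphism has a pseudo $0$-kernel). A pseudo $\infty$-kernel of $f$ is an infinite chain $(f_i)_{i\ge 1}$, $f_i:x_i\to x_{i-1}$, $x_0=x$, with the same property for all $i\geq 0$. Put $x_{-1}=y$. **Proposition.** Let $\mathcal C$ be a small additive category and $n\ge 1$. The following are equivalent. (1) $\mathcal C$ is right regular $n$-coherent. (2) Both of the following conditions hold. (i) Every morphism of $\mathcal C$ that has a pseudo $(n-1)$-kernel has a pseudo $n$-kernel. (ii) For every morphism $f=f_0:x\to y$ of $\mathcal C$ and every pseudo $\infty$-kernel $(f_i)_{i\ge1}$ of $f$, there exist an integer $k\ge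 1$ and an endomorphism $\alpha:x_{k-1}\to x_{k-1}$ with $\alpha\circ f_k=0$ and $f_{k-1}\circ\alpha=f_{k-1}$. -/

import Mathlib

open CategoryTheory CategoryTheory.Limits Opposite

universe u

namespace PseudoKer

/-! ### Pseudo kernels -/

section PseudoKernels

variable {C : Type u} [SmallCategory C] [Preadditive C]

/-- `g : k ⟶ x` is a pseudo kernel of `f : x ⟶ y`: `f ∘ g = 0` and every `h : c ⟶ x` with
`f ∘ h = 0` factors through `g`. Equivalently, `Hom(-, k) ⟶ Hom(-, x) ⟶ Hom(-, y)` is exact. -/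
def IsPseudoKernel {k x y : C} (g : k ⟶ x) (f : x ⟶ y) : Prop :=
  g ≫ f = 0 ∧ ∀ ⦃c : C⦄ (h : c ⟶ x), h ≫ f = 0 → ∃ t : c ⟶ k, t ≫ g = h

/-- `f` has a pseudo `n`-kernel: there is a chain `xₙ ⟶ ⋯ ⟶ x₁ ⟶ x ⟶ y` of morphisms
`fₙ, …, f₁, f₀ = f` such that `Hom(-, xₙ) ⟶ ⋯ ⟶ Hom(-, x₁) ⟶ Hom(-, x) ⟶ Hom(-, y)` is exact,
that is, each `fᵢ₊₁` is a pseudo kernel of `fᵢ`. For `n = 0` there is no condition. -/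
def HasPseudoNKernel : ℕ → ∀ {x y : C}, (x ⟶ y) → Prop
  | 0, _, _, _ => True
  | n + 1, x, _, f => ∃ (x₁ : C) (f₁ : x₁ ⟶ x), IsPseudoKernel f₁ f ∧ HasPseudoNKernel n f₁

/-- A pseudo `∞`-kernel of `f : x ⟶ y`: an infinite chain `⋯ ⟶ x₂ ⟶ x₁ ⟶ x ⟶ y` ending in `f`
such that `⋯ ⟶ Hom(-, x₂) ⟶ Hom(-, x₁) ⟶ Hom(-, x) ⟶ Hom(-, y)` is exact.
Here `next i = xᵢ₊₁`, `map₁ = f₁` and `map i = fᵢ₊₂`. -/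
structure PseudoInftyKernel {x y : C} (f : x ⟶ y) where
  next : ℕ → C
  map₁ : next 0 ⟶ x
  map : ∀ i, next (i + 1) ⟶ next i
  exact₀ : IsPseudoKernel map₁ f
  exact₁ : IsPseudoKernel (map 0) map₁
  exact_succ : ∀ i, IsPseudoKernel (map (i + 1)) (map i)

namespace PseudoInftyKernel

variable {x y : C} {f : x ⟶ y}

/-- The object `xᵢ` of the chain, with `x₀ = x`. -/
def src (K : PseudoInftyKernel f) : ℕ → C
  | 0 => x
  | i + 1 => K.next i

/-- The target `xᵢ₋₁` of `fᵢ`: it is `y` for `i = 0`, and `xᵢ₋₁` for `i ≥ 1`. -/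
def tgt (K : PseudoInftyKernel f) : ℕ → C
  | 0 => y
  | i + 1 => K.src i

/-- The morphism `fᵢ : xᵢ ⟶ xᵢ₋₁` of the chain, with `f₀ = f`. -/
def mor (K : PseudoInftyKernel f) : ∀ i, K.src i ⟶ K.tgt i
  | 0 => f
  | 1 => K.map₁
  | i + 2 => K.map i

end PseudoInftyKernel

end PseudoKernels

/-! ### The abelian category of right modules over `C` -/

section Additive

variable (C : Type u) [SmallCategory C] [Preadditive C]

open ZeroObject in
instance : (additiveFunctor Cᵒᵖ AddCommGrpCat.{u}).ContainsZero where
  exists_zero := ⟨0, isZero_zero _, inferInstanceAs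
    (Functor.Additive (0 : Cᵒᵖ ⥤ AddCommGrpCat.{u}))⟩

instance : (additiveFunctor Cᵒᵖ AddCommGrpCat.{u}).IsClosedUnderSubobjects where
  prop_of_mono {F G} i _ hG := by
    have : G.Additive := hG
    refine ⟨fun {a b f g} => ?_⟩
    rw [← cancel_mono (i.app b)]
    simp [Preadditive.add_comp, Functor.map_add]

instance : (additiveFunctor Cᵒᵖ AddCommGrpCat.{u}).IsClosedUnderQuotients where
  prop_of_epi {F G} p _ hF := by
    have : F.Additive := hF
    refine ⟨fun {a b f g} => ?_⟩
    rw [← cancel_epi (p.app a)]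
    simp [Preadditive.comp_add, Functor.map_add, ← NatTrans.naturality, Preadditive.add_comp]

instance : (additiveFunctor Cᵒᵖ AddCommGrpCat.{u}).IsClosedUnderFiniteProducts where
  isClosedUnderLimitsOfShape J _ := ⟨by
    rintro G ⟨h⟩
    have hadd : ∀ j, (h.diag.obj j).Additive := h.prop_diag_obj
    refine ⟨fun {a b f g} => ?_⟩
    refine (isLimitOfPreserves ((evaluation _ _).obj b) h.isLimit).hom_ext fun j => ?_
    have := hadd j
    simp [Preadditive.add_comp, Functor.map_add]⟩

/-- The category `Fun(Cᵒᵖ, Ab)` of right `C`-modules: additive functors `Cᵒᵖ ⥤ Ab`. -/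
abbrev RightMod := Cᵒᵖ ⥤+ AddCommGrpCat.{u}

noncomputable instance : Abelian (RightMod C) := inferInstance

instance : HasFiniteBiproducts (RightMod C) := Abelian.hasFiniteBiproducts

end Additive

/-! ### Finiteness conditions on right modules, coherence and regularity -/

section Coherence

variable {C : Type u} [SmallCategory C] [Preadditive C]

/-- The representable right module `Hom(-, c)`. -/
def representable (c : C) : RightMod C :=
  AdditiveFunctor.of (preadditiveYoneda.obj c)

/-- `F` is finitely generated: there is an epimorphism onto `F` from a finite direct sum of
representable modules. -/
def FinGen (F : RightMod C) : Prop :=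
  ∃ (m : ℕ) (c : Fin m → C) (p : (⨁ fun j => representable (c j)) ⟶ F), Epi p

/-- `F` is of type `FPₙ`: there is an exact sequence `Pₙ ⟶ ⋯ ⟶ P₁ ⟶ P₀ ⟶ F ⟶ 0` with all `Pᵢ`
finitely generated projective. This is expressed by recursion on `n`: `FP₀` means finitely
generated, and `F` is of type `FPₙ₊₁` if there is an epimorphism `P₀ ⟶ F` with `P₀` finitely
generated projective whose kernel is of type `FPₙ`. -/
def IsFP : ℕ → RightMod C → Prop
  | 0, F => FinGen F
  | n + 1, F => ∃ (P : RightMod C) (p : P ⟶ F),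
      FinGen P ∧ Projective P ∧ Epi p ∧ IsFP n (kernel p)

/-- `F` is of type `FPₙ₋₁`; by convention every module is of type `FP₋₁`. -/
def IsFPPred : ℕ → RightMod C → Prop
  | 0, _ => True
  | n + 1, F => IsFP n F

/-- `F` is an `n`-coherent module: it is of type `FPₙ`, and each subobject of `F` that is of type
`FPₙ₋₁` is of type `FPₙ`. -/
def IsCoherentModule (n : ℕ) (F : RightMod C) : Prop :=
  IsFP n F ∧ ∀ S : Subobject F, IsFPPred n (S : RightMod C) → IsFP n (S : RightMod C)

variable (C) in
/-- `C` is right `n`-coherent: every right module of type `FPₙ` is `n`-coherent. -/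
def IsRightCoherent (n : ℕ) : Prop :=
  ∀ F : RightMod C, IsFP n F → IsCoherentModule n F

variable (C) in
/-- `C` is right regular `n`-coherent: it is right `n`-coherent and every right module of type
`FPₙ` has finite projective dimension. -/
def IsRightRegularCoherent (n : ℕ) : Prop :=
  IsRightCoherent C n ∧
    ∀ F : RightMod C, IsFP n F → ∃ d : ℕ, HasProjectiveDimensionLE F d

end Coherence

end PseudoKer

/-! Let `yo` be the Yoneda embedding. A pseudo kernel of `f` is a representable cover of `ker (yo
f)`, so by dimension shifting `f` has a pseudo `m`-kernel iff `coker (yo f)` is of type FP_{m+1}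
(`hasPseudoNKernel_iff`, `isFP_iff_of_presentation`). Every module of type FP₁ is such a cokernel.
Hence, for `n = m + 1`, (i) says that FP_n implies FP_{n+1}, which is equivalent to `n`-coherence by
the closure of FP_n under short exact sequences.

A pseudo `∞`-kernel is a resolution of `coker (yo f)` by representables. An `α` as in (ii) makes the
syzygy `ker (yo fⱼ)` a direct summand, hence projective; conversely a projective syzygy yields such
an `α` one place further on. So (ii) is finiteness of projective dimension, and (i) provides the
`∞`-kernels. -/

namespace CategoryTheory.ShortComplex

/-! ### Short exact sequences in abelian categories -/

variable {A : Type*} [Category* A] [Abelian A]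

/-- The kernels of an epimorphism `f`, of `f ≫ g` and of `g` form a short exact sequence. -/
lemma shortExact_kernel_comp {X Y Z : A} (f : X ⟶ Y) (g : Y ⟶ Z) [Epi f] :
    (ShortComplex.mk (kernel.map f (f ≫ g) (𝟙 X) g (by simp))
      (kernel.map (f ≫ g) g f (𝟙 Z) (by simp)) (by ext; simp)).ShortExact where
  exact := by
    rw [exact_iff_exact_up_to_refinements]
    intro T x hx
    have hx' : x ≫ kernel.ι (f ≫ g) ≫ f = 0 := by
      simpa using hx =≫ kernel.ι g
    refine ⟨T, 𝟙 T, inferInstance, kernel.lift f (x ≫ kernel.ι (f ≫ g)) (by simpa using hx'), ?_⟩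
    rw [← cancel_mono (kernel.ι (f ≫ g))]
    simp
  mono_f := mono_of_mono_fac (kernel.lift_ι _ _ _)
  epi_g := by
    refine (epi_iff_surjective_up_to_refinements _).2 fun T y ↦ ?_
    obtain ⟨T', π, hπ, x, hx⟩ := surjective_up_to_refinements_of_epi f (y ≫ kernel.ι g)
    refine ⟨T', π, hπ, kernel.lift (f ≫ g) x (by simp [← reassoc_of% hx]), ?_⟩
    rw [← cancel_mono (kernel.ι g)]
    simpa using hx

variable {S : ShortComplex A} {P Q : A}

lemma ShortExact.epi_desc (hS : S.ShortExact) (p : P ⟶ S.X₁) [Epi p] (l : Q ⟶ S.X₂)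
    [Epi (l ≫ S.g)] : Epi (biprod.desc (p ≫ S.f) l) := by
  have := hS.mono_f
  refine (epi_iff_surjective_up_to_refinements _).2 fun T y ↦ ?_
  obtain ⟨T₁, π₁, h₁, q, hq⟩ := surjective_up_to_refinements_of_epi (l ≫ S.g) (y ≫ S.g)
  obtain ⟨T₂, π₂, h₂, x, hx⟩ := hS.exact.exact_up_to_refinements (π₁ ≫ y - q ≫ l)
    (by simp [hq])
  obtain ⟨T₃, π₃, h₃, w, hw⟩ := surjective_up_to_refinements_of_epi p x
  refine ⟨T₃, π₃ ≫ π₂ ≫ π₁, inferInstance, biprod.lift w (π₃ ≫ π₂ ≫ q), ?_⟩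
  have e : π₃ ≫ π₂ ≫ (π₁ ≫ y - q ≫ l) = w ≫ p ≫ S.f := by
    rw [hx, reassoc_of% hw]
  simp only [Preadditive.comp_sub] at e
  simp [biprod.lift_desc, ← e]

/-- The kernels in the horseshoe lemma. -/
lemma ShortExact.shortExact_kernel_desc (hS : S.ShortExact) (p : P ⟶ S.X₁) [Epi p]
    (l : Q ⟶ S.X₂) :
    (ShortComplex.mk
      (kernel.map p (biprod.desc (p ≫ S.f) l) biprod.inl S.f (by simp))
      (kernel.map (biprod.desc (p ≫ S.f) l) (l ≫ S.g) biprod.snd S.g (by ext <;> simp))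
      (by ext; simp)).ShortExact where
  exact := by
    have := hS.mono_f
    rw [exact_iff_exact_up_to_refinements]
    intro T x hx
    have h₂ : x ≫ kernel.ι _ ≫ biprod.snd = 0 := by simpa using hx =≫ kernel.ι (l ≫ S.g)
    have h₁ : x ≫ kernel.ι (biprod.desc (p ≫ S.f) l) =
        (x ≫ kernel.ι _ ≫ biprod.fst) ≫ biprod.inl := by
      ext <;> simp [h₂]
    have h₀ : (x ≫ kernel.ι (biprod.desc (p ≫ S.f) l) ≫ biprod.fst) ≫ p = 0 := by
      rw [← cancel_mono S.f]
      have := x ≫= kernel.condition (biprod.desc (p ≫ S.f) l)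
      rw [← Category.assoc, h₁] at this
      simpa using this
    refine ⟨T, 𝟙 T, inferInstance, kernel.lift p _ h₀, ?_⟩
    rw [← cancel_mono (kernel.ι _)]
    simpa using h₁
  mono_f := mono_of_mono_fac (kernel.lift_ι _ _ _)
  epi_g := by
    refine (epi_iff_surjective_up_to_refinements _).2 fun T y ↦ ?_
    obtain ⟨T₁, π₁, h₁, x, hx⟩ := hS.exact.exact_up_to_refinements (y ≫ kernel.ι _ ≫ l) (by simp)
    obtain ⟨T₂, π₂, h₂, w, hw⟩ := surjective_up_to_refinements_of_epi p x
    refine ⟨T₂, π₂ ≫ π₁, inferInstance, kernel.lift _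
      (biprod.lift (-w) (π₂ ≫ π₁ ≫ y ≫ kernel.ι _)) ?_, ?_⟩
    · simp [biprod.lift_desc, hx, reassoc_of% hw]
    · rw [← cancel_mono (kernel.ι _)]
      simp

/-- Pulling back a short exact sequence along `p : P ⟶ S.X₃`. -/
lemma ShortExact.shortExact_pullback (hS : S.ShortExact) (p : P ⟶ S.X₃) :
    (ShortComplex.mk (pullback.lift 0 S.f (by simp) : S.X₁ ⟶ pullback p S.g)
      (pullback.fst p S.g) (pullback.lift_fst _ _ _)).ShortExact where
  exact := by
    rw [exact_iff_exact_up_to_refinements]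
    intro T x hx
    dsimp at x hx
    obtain ⟨T', π, hπ, z, hz⟩ := hS.exact.exact_up_to_refinements (x ≫ pullback.snd p S.g)
      (by rw [Category.assoc, ← pullback.condition, ← Category.assoc, hx, zero_comp])
    refine ⟨T', π, hπ, z, ?_⟩
    apply pullback.hom_ext
    · rw [Category.assoc, Category.assoc, pullback.lift_fst, hx, comp_zero, comp_zero]
    · rw [Category.assoc, Category.assoc, pullback.lift_snd, hz]
  mono_f := by
    have := hS.mono_f
    exact mono_of_mono_fac (pullback.lift_snd _ _ _)
  epi_g := by
    have := hS.epi_g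
    dsimp
    infer_instance

lemma shortExact_kernel {X Y : A} (f : X ⟶ Y) [Epi f] :
    (ShortComplex.mk (kernel.ι f) f (kernel.condition f)).ShortExact where
  exact := exact_of_f_is_kernel _ (kernelIsKernel f)

end CategoryTheory.ShortComplex

namespace PseudoKer

/-! ### Representable modules -/

variable {C : Type u} [SmallCategory C] [Preadditive C]

variable (C) in
/-- The Yoneda embedding of `C` into right `C`-modules. -/
def yo : C ⥤ RightMod C :=
  (additiveFunctor Cᵒᵖ AddCommGrpCat.{u}).lift preadditiveYoneda fun c ↦
    inferInstanceAs (preadditiveYoneda.obj c).Additive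

instance : (yo C).Additive where
  map_add := by
    intro X Y f g
    ext c h
    exact Preadditive.comp_add _ _ _ h f g

instance : (yo C).Full :=
  Functor.Full.of_comp_faithful_iso (G := (additiveFunctor Cᵒᵖ AddCommGrpCat.{u}).ι)
    (H := preadditiveYoneda) (Iso.refl _)
instance : (yo C).Faithful :=
  Functor.Faithful.of_comp_iso (G := (additiveFunctor Cᵒᵖ AddCommGrpCat.{u}).ι)
    (H := preadditiveYoneda) (Iso.refl _)

/-- The morphism out of a representable module given by an element. -/
def ofElement {F : RightMod C} {c : C} (x : F.obj.obj (op c)) : (yo C).obj c ⟶ F :=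
  ObjectProperty.homMk
    { app d := AddCommGrpCat.ofHom
        (AddMonoidHom.mk' (fun g : d.unop ⟶ c ↦ F.obj.map g.op x) fun g h ↦ by
          have : (g + h).op = g.op + h.op := rfl
          simp [this])
      naturality d e g := by
        ext h
        exact congr($(F.obj.map_comp (Quiver.Hom.op (h : d.unop ⟶ c)) g) x) }

/-- The identity as an element of the representable module. -/
def idElement (c : C) : ((yo C).obj c).obj.obj (op c) := (𝟙 c : c ⟶ c)

lemma ofElement_idElement {F : RightMod C} {c : C} (x : F.obj.obj (op c)) :
    (ofElement x).hom.app (op c) (idElement c) = x :=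
  congr($(F.obj.map_id (op c)) x)

lemma hom_yo_ext {F : RightMod C} {c : C} {f g : (yo C).obj c ⟶ F}
    (h : f.hom.app (op c) (idElement c) = g.hom.app (op c) (idElement c)) : f = g := by
  ext d (t : d.unop ⟶ c)
  have hf := congr($(f.hom.naturality t.op) (idElement c))
  have hg := congr($(g.hom.naturality t.op) (idElement c))
  have ht : ((yo C).obj c).obj.map t.op (idElement c) = t := Category.comp_id t
  simp only [ConcreteCategory.comp_apply, ht] at hf hg
  exact hf.trans ((congrArg _ h).trans hg.symm)

instance (c : C) : Projective ((yo C).obj c) where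
  factors {E X} f e he := by
    have : (additiveFunctor Cᵒᵖ AddCommGrpCat.{u}).ι.PreservesEpimorphisms :=
      ObjectProperty.preservesEpimorphisms_ι_of_isNormalMonoCategory _
    have : Epi e.hom := inferInstanceAs (Epi ((ObjectProperty.ι _).map e))
    have : Epi (e.hom.app (op c)) := inferInstance
    obtain ⟨x, hx⟩ := (AddCommGrpCat.epi_iff_surjective _).1 this
      (f.hom.app (op c) (idElement c))
    refine ⟨ofElement x, hom_yo_ext ?_⟩
    exact (congrArg (e.hom.app (op c)) (ofElement_idElement x)).trans hx

/-- Maps out of representables are elements, so lifting them is pointwise surjectivity. -/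
lemma epi_of_yo_lift {F G : RightMod C} (f : F ⟶ G)
    (h : ∀ (c : C) (g : (yo C).obj c ⟶ G), ∃ l, l ≫ f = g) : Epi f := by
  have (c : Cᵒᵖ) : Epi (f.hom.app c) := by
    rw [AddCommGrpCat.epi_iff_surjective]
    intro x
    obtain ⟨l, hl⟩ := h c.unop (ofElement x)
    refine ⟨l.hom.app c (idElement c.unop), ?_⟩
    exact congr(($hl).hom.app c (idElement c.unop)).trans (ofElement_idElement x)
  have : Epi ((additiveFunctor Cᵒᵖ AddCommGrpCat.{u}).ι.map f) :=
    NatTrans.epi_of_epi_app f.hom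
  exact (additiveFunctor Cᵒᵖ AddCommGrpCat.{u}).ι.epi_of_epi_map this

end PseudoKer

namespace CategoryTheory.ShortComplex

variable {A : Type*} [Category* A] [Abelian A]

lemma shortExact_kernel_of_fac {X Y I : A} {f : X ⟶ Y} (q : X ⟶ I) (i : I ⟶ Y) [Epi q] [Mono i]
    (w : q ≫ i = f) :
    (ShortComplex.mk (kernel.ι f) q (by simp [← cancel_mono i, w])).ShortExact where
  exact := exact_of_f_is_kernel _ <| KernelFork.IsLimit.ofι' _ _ fun k hk ↦
    ⟨kernel.lift f k (by rw [← w, reassoc_of% hk, zero_comp]), by simp⟩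

end CategoryTheory.ShortComplex

namespace PseudoKer

/-! ### Closure properties of type FP_n -/

variable {C : Type u} [SmallCategory C] [Preadditive C]

lemma FinGen.of_epi {F G : RightMod C} (hF : FinGen F) (f : F ⟶ G) [Epi f] : FinGen G := by
  obtain ⟨m, c, p, hp⟩ := hF
  exact ⟨m, c, p ≫ f, epi_comp _ _⟩

lemma finGen_yo (c : C) : FinGen ((yo C).obj c) :=
  ⟨1, fun _ ↦ c, biproduct.π (fun _ : Fin 1 ↦ representable c) 0,
    (IsSplitEpi.mk' ⟨biproduct.ι _ 0, biproduct.ι_π_self _ 0⟩).epi⟩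

lemma IsFP.of_iso {n : ℕ} {F G : RightMod C} (hF : IsFP n F) (e : F ≅ G) : IsFP n G := by
  induction n generalizing F G with
  | zero => exact FinGen.of_epi hF e.hom
  | succ n ih =>
    obtain ⟨P, p, hP, hP', hp, h⟩ := hF
    exact ⟨P, p ≫ e.hom, hP, hP', inferInstance, ih h (kernelCompMono p e.hom).symm⟩

lemma isFP_of_isZero (n : ℕ) {F : RightMod C} (hF : IsZero F) : IsFP n F := by
  have h₀ : FinGen F := ⟨0, Fin.elim0, 0, ⟨fun _ _ _ ↦ hF.eq_of_src _ _⟩⟩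
  induction n generalizing F with
  | zero => exact h₀
  | succ n ih =>
    have hk : IsZero (kernel (𝟙 F)) := isZero_kernel_of_mono _
    exact ⟨F, 𝟙 F, h₀, ⟨fun f e _ ↦ ⟨0, hF.eq_of_src _ _⟩⟩, inferInstance,
      ih hk ⟨0, Fin.elim0, 0, ⟨fun _ _ _ ↦ hk.eq_of_src _ _⟩⟩⟩

lemma FinGen.isFP {P : RightMod C} (hP : FinGen P) [Projective P] (n : ℕ) : IsFP n P := by
  cases n with
  | zero => exact hP
  | succ n => exact ⟨P, 𝟙 P, hP, inferInstance, inferInstance,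
      isFP_of_isZero n (isZero_kernel_of_mono _)⟩

lemma isFP_yo (n : ℕ) (c : C) : IsFP n ((yo C).obj c) := (finGen_yo c).isFP n

lemma FinGen.isFPPred {P : RightMod C} (hP : FinGen P) [Projective P] :
    ∀ n, IsFPPred n P
  | 0 => trivial
  | n + 1 => hP.isFP n

variable {S : ShortComplex (RightMod C)}

/-- The first term of a short exact sequence is the kernel of the epimorphism. -/
noncomputable def kernelIso (hS : S.ShortExact) : kernel S.g ≅ S.X₁ :=
  (kernelIsKernel S.g).conePointUniqueUpToIso hS.fIsKernel

variable [HasFiniteBiproducts C]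

/-- The Yoneda embedding is additive, so a finite sum of representables is again representable. -/
lemma FinGen.exists_epi {F : RightMod C} (hF : FinGen F) :
    ∃ (c : C) (p : (yo C).obj c ⟶ F), Epi p := by
  obtain ⟨m, c, p, hp⟩ := hF
  exact ⟨⨁ c, ((yo C).mapBiproduct c).hom ≫ p, epi_comp' inferInstance hp⟩

lemma FinGen.biprod {F G : RightMod C} (hF : FinGen F) (hG : FinGen G) : FinGen (F ⊞ G) := by
  have := hasBinaryBiproducts_of_finite_biproducts C
  have := preservesBinaryBiproducts_of_preservesBiproducts (yo C)
  obtain ⟨c, p, hp⟩ := hF.exists_epi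
  obtain ⟨d, q, hq⟩ := hG.exists_epi
  exact (finGen_yo (c ⊞ d)).of_epi (((yo C).mapBiprod c d).hom ≫ biprod.map p q)

omit [HasFiniteBiproducts C] in
lemma IsFP.finGen {n : ℕ} {F : RightMod C} (hF : IsFP n F) : FinGen F := by
  cases n with
  | zero => exact hF
  | succ n =>
    obtain ⟨P, p, hP, -, hp, -⟩ := hF
    exact hP.of_epi p

/-- An extension of modules of type `FPₙ` is of type `FPₙ`. -/
lemma IsFP.of_shortExact₂ {n : ℕ} (hS : S.ShortExact) (h₁ : IsFP n S.X₁) (h₃ : IsFP n S.X₃) :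
    IsFP n S.X₂ := by
  have := hS.epi_g
  induction n generalizing S with
  | zero =>
    obtain ⟨c, p, hp⟩ := FinGen.exists_epi h₁
    obtain ⟨d, q, hq⟩ := FinGen.exists_epi h₃
    have : Epi (Projective.factorThru q S.g ≫ S.g) := by rwa [Projective.factorThru_comp]
    have := hS.epi_desc p (Projective.factorThru q S.g)
    exact ((finGen_yo c).biprod (finGen_yo d)).of_epi (biprod.desc (p ≫ S.f) (Projective.factorThru q S.g))
  | succ n ih =>
    obtain ⟨P, p, hP, hP', hp, hp'⟩ := h₁
    obtain ⟨Q, q, hQ, hQ', hq, hq'⟩ := h₃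
    obtain ⟨l, rfl⟩ := Projective.factors q S.g
    have hS' := hS.shortExact_kernel_desc p l
    exact ⟨P ⊞ Q, biprod.desc (p ≫ S.f) l, hP.biprod hQ, inferInstance, hS.epi_desc p l,
      ih hS' hp' hq' hS'.epi_g⟩

/-- The quotient of a module of type `FPₙ` by a submodule of type `FPₙ₋₁` is of type `FPₙ`. -/
lemma IsFP.of_shortExact₃ {n : ℕ} (hS : S.ShortExact) (h₁ : IsFPPred n S.X₁)
    (h₂ : IsFP n S.X₂) : IsFP n S.X₃ := by
  have := hS.epi_g
  cases n with
  | zero => exact FinGen.of_epi h₂ S.g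
  | succ n =>
    obtain ⟨P, p, hP, hP', hp, hp'⟩ := h₂
    exact ⟨P, p ≫ S.g, hP, hP', inferInstance, .of_shortExact₂
      (ShortComplex.shortExact_kernel_comp p S.g) hp' (IsFP.of_iso h₁ (kernelIso hS).symm)⟩

/-- The kernel of an epimorphism from a module of type `FPₙ` onto a module of type `FPₙ₊₁` is of
type `FPₙ`. -/
lemma IsFP.of_shortExact₁ {n : ℕ} (hS : S.ShortExact) (h₂ : IsFP n S.X₂)
    (h₃ : IsFP (n + 1) S.X₃) : IsFP n S.X₁ := by
  obtain ⟨P, p, hP, hP', hp, hp'⟩ := h₃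
  -- The pullback is an extension of `S.X₂` by `kernel p`. As `P` is projective it also splits as
  -- `S.X₁ ⊕ P`, so `S.X₁` is its quotient by `P`.
  have hX : IsFP n (pullback p S.g) :=
    .of_iso (.of_shortExact₂ ((ShortComplex.shortExact_kernel p).shortExact_pullback S.g) hp' h₂)
      (pullbackSymmetry _ _)
  have s := (hS.shortExact_pullback p).splittingOfProjective
  have s' : (ShortComplex.mk s.s s.r s.s_r).Splitting :=
    { r := pullback.fst p S.g
      s := pullback.lift 0 S.f (by simp)
      f_r := s.s_g
      s_g := s.f_r
      id := (add_comm _ _).trans s.id }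
  exact .of_shortExact₃ s'.shortExact (FinGen.isFPPred hP n) hX

lemma IsFP.isFPPred {n : ℕ} {F : RightMod C} (hF : IsFP n F) : IsFPPred n F := by
  induction n generalizing F with
  | zero => trivial
  | succ n ih =>
    obtain ⟨P, p, hP, hP', hp, hp'⟩ := hF
    exact .of_shortExact₃ (ShortComplex.shortExact_kernel p) (ih hp') (hP.isFP n)

lemma IsFP.isFPPred_of_shortExact {n : ℕ} (hS : S.ShortExact) (h₂ : IsFP n S.X₂)
    (h₃ : IsFP n S.X₃) : IsFPPred n S.X₁ := by
  cases n with
  | zero => trivial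
  | succ n => exact .of_shortExact₁ hS h₂.isFPPred h₃

end PseudoKer

namespace PseudoKer

/-! ### Pseudo kernels and syzygies -/

variable {C : Type u} [SmallCategory C] [Preadditive C]

namespace IsPseudoKernel

variable {k x y : C} {g : k ⟶ x} {f : x ⟶ y}

lemma map_yo_comp (h : IsPseudoKernel g f) : (yo C).map g ≫ (yo C).map f = 0 := by
  rw [← Functor.map_comp, h.1, Functor.map_zero]

/-- The epimorphism from a representable module onto the kernel given by a pseudo kernel. -/
noncomputable def toKernel (h : IsPseudoKernel g f) :
    (yo C).obj k ⟶ kernel ((yo C).map f) :=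
  kernel.lift _ ((yo C).map g) h.map_yo_comp

@[simp]
lemma toKernel_ι (h : IsPseudoKernel g f) :
    h.toKernel ≫ kernel.ι ((yo C).map f) = (yo C).map g :=
  kernel.lift_ι _ _ _

instance (h : IsPseudoKernel g f) : Epi h.toKernel :=
  epi_of_yo_lift _ fun c s ↦ by
    have hs : (yo C).preimage (s ≫ kernel.ι _) ≫ f = 0 :=
      (yo C).map_injective (by simp)
    obtain ⟨t, ht⟩ := h.2 _ hs
    refine ⟨(yo C).map t, ?_⟩
    rw [← cancel_mono (kernel.ι _), Category.assoc, toKernel_ι, ← Functor.map_comp, ht,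
      Functor.map_preimage]

lemma shortExact (h : IsPseudoKernel g f) :
    (ShortComplex.mk (kernel.ι ((yo C).map g)) h.toKernel
      (by simp [← cancel_mono (kernel.ι ((yo C).map f))])).ShortExact :=
  ShortComplex.shortExact_kernel_of_fac h.toKernel (kernel.ι _) h.toKernel_ι

/-- Since `g` covers the kernel, `α` vanishes on it, and `1 - α` retracts `yo x` onto it. -/
lemma projective_kernel (h : IsPseudoKernel g f) (α : x ⟶ x) (h₁ : g ≫ α = 0)
    (h₂ : α ≫ f = f) : Projective (kernel ((yo C).map f)) := by
  have h₀ : kernel.ι ((yo C).map f) ≫ (yo C).map α = 0 := by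
    rw [← cancel_epi h.toKernel, reassoc_of% h.toKernel_ι, ← Functor.map_comp, h₁, Functor.map_zero,
      comp_zero]
  have r : Retract (kernel ((yo C).map f)) ((yo C).obj x) :=
    { i := kernel.ι _
      r := kernel.lift _ (𝟙 _ - (yo C).map α) (by simp [← Functor.map_comp, h₂])
      retract := by
        rw [← cancel_mono (kernel.ι _)]
        simp [h₀] }
  exact r.projective

/-- Here `α` is the cover of the kernel by `yo k` followed by a section of it. -/
lemma exists_endomorphism (h : IsPseudoKernel g f) [Projective (kernel ((yo C).map f))] :
    ∃ α : k ⟶ k, (∀ ⦃c : C⦄ (t : c ⟶ k), t ≫ g = 0 → t ≫ α = 0) ∧ α ≫ g = g := by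
  refine ⟨(yo C).preimage (h.toKernel ≫ Projective.factorThru (𝟙 _) h.toKernel), ?_, ?_⟩
  · intro c t ht
    apply (yo C).map_injective
    have : (yo C).map t ≫ h.toKernel = 0 := by
      rw [← cancel_mono (kernel.ι _), Category.assoc, toKernel_ι, ← Functor.map_comp, ht]
      simp
    simp [reassoc_of% this]
  · apply (yo C).map_injective
    rw [Functor.map_comp, Functor.map_preimage, ← h.toKernel_ι, Category.assoc,
      Projective.factorThru_comp_assoc, Category.id_comp]

lemma hasProjectiveDimensionLT_iff (h : IsPseudoKernel g f) (d : ℕ) :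
    HasProjectiveDimensionLT (kernel ((yo C).map f)) (d + 2) ↔
      HasProjectiveDimensionLT (kernel ((yo C).map g)) (d + 1) :=
  h.shortExact.hasProjectiveDimensionLT_X₃_iff d (inferInstanceAs (Projective ((yo C).obj k)))

lemma isFP_kernel_iff [HasFiniteBiproducts C] (h : IsPseudoKernel g f) (n : ℕ) :
    IsFP n (kernel ((yo C).map f)) ↔ IsFPPred n (kernel ((yo C).map g)) :=
  ⟨fun hf ↦ IsFP.isFPPred_of_shortExact h.shortExact (isFP_yo n k) hf,
    fun hg ↦ .of_shortExact₃ h.shortExact hg (isFP_yo n k)⟩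

end IsPseudoKernel

lemma FinGen.exists_isPseudoKernel [HasFiniteBiproducts C] {x y : C} {f : x ⟶ y}
    (hf : FinGen (kernel ((yo C).map f))) :
    ∃ (k : C) (g : k ⟶ x), IsPseudoKernel g f := by
  obtain ⟨k, p, hp⟩ := hf.exists_epi
  refine ⟨k, (yo C).preimage (p ≫ kernel.ι _), (yo C).map_injective (by simp), fun c t ht ↦ ?_⟩
  have ht' : (yo C).map t ≫ (yo C).map f = 0 := by
    rw [← Functor.map_comp, ht, Functor.map_zero]
  refine ⟨(yo C).preimage (Projective.factorThru (kernel.lift _ _ ht') p),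
    (yo C).map_injective ?_⟩
  simp

lemma hasPseudoNKernel_iff [HasFiniteBiproducts C] (n : ℕ) {x y : C} (f : x ⟶ y) :
    HasPseudoNKernel n f ↔ IsFPPred n (kernel ((yo C).map f)) := by
  induction n generalizing x y with
  | zero => exact Iff.rfl
  | succ n ih =>
    constructor
    · rintro ⟨k, g, h, hg⟩
      exact (h.isFP_kernel_iff n).2 ((ih g).1 hg)
    · intro hf
      obtain ⟨k, g, h⟩ := (IsFP.finGen hf).exists_isPseudoKernel
      exact ⟨k, g, h, (ih g).2 ((h.isFP_kernel_iff n).1 hf)⟩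

namespace PseudoInftyKernel

variable {x y : C} {f : x ⟶ y} (K : PseudoInftyKernel f)

lemma isPseudoKernel_mor (j : ℕ) :
    IsPseudoKernel (x := K.src j) (K.mor (j + 1)) (K.mor j) :=
  match j with
  | 0 => K.exact₀
  | 1 => K.exact₁
  | j + 2 => K.exact_succ j

lemma hasPseudoNKernel (n j : ℕ) : HasPseudoNKernel n (K.mor j) := by
  induction n generalizing j with
  | zero => trivial
  | succ n ih => exact ⟨_, _, K.isPseudoKernel_mor j, ih (j + 1)⟩

lemma hasProjectiveDimensionLT_iff (j d : ℕ) :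
    HasProjectiveDimensionLT (kernel ((yo C).map f)) (j + d + 1) ↔
      HasProjectiveDimensionLT (kernel ((yo C).map (K.mor j))) (d + 1) := by
  induction j generalizing d with
  | zero => rw [zero_add]; exact Iff.rfl
  | succ j ih =>
    rw [show j + 1 + d + 1 = j + (d + 1) + 1 by lia, ih]
    exact (K.isPseudoKernel_mor j).hasProjectiveDimensionLT_iff d

lemma exists_endomorphism_iff :
    (∃ (j : ℕ) (α : K.src j ⟶ K.src j), K.mor (j + 1) ≫ α = 0 ∧ α ≫ K.mor j = K.mor j) ↔
      ∃ d, HasProjectiveDimensionLT (kernel ((yo C).map f)) d := by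
  constructor
  · rintro ⟨j, α, h₁, h₂⟩
    have := (K.isPseudoKernel_mor j).projective_kernel α h₁ h₂
    exact ⟨j + 0 + 1, (K.hasProjectiveDimensionLT_iff j 0).2 inferInstance⟩
  · rintro ⟨d, hd⟩
    -- Dimension `< 1` is projectivity, so the `d`-th syzygy is projective; its cover lives on
    -- `K.src (d + 1)`.
    have := (K.hasProjectiveDimensionLT_iff d 0).1
      (hasProjectiveDimensionLT_of_ge _ d _ (by lia))
    obtain ⟨α, h₁, h₂⟩ := (K.isPseudoKernel_mor d).exists_endomorphism
    exact ⟨d + 1, α, h₁ _ (K.isPseudoKernel_mor (d + 1)).1, h₂⟩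

end PseudoInftyKernel

/-- If pseudo `m`-kernels can be prolonged, they can be prolonged to pseudo `∞`-kernels. -/
lemma nonempty_pseudoInftyKernel {m : ℕ}
    (H : ∀ (x y : C) (f : x ⟶ y), HasPseudoNKernel m f → HasPseudoNKernel (m + 1) f)
    {x y : C} (f : x ⟶ y) (hf : HasPseudoNKernel m f) : Nonempty (PseudoInftyKernel f) := by
  -- By `hg'` the chosen pseudo kernel again has a pseudo `m`-kernel, so the choice can be iterated.
  choose X g hg hg' using H
  let step : (Σ' (x y : C) (f : x ⟶ y), HasPseudoNKernel m f) →
      (Σ' (x y : C) (f : x ⟶ y), HasPseudoNKernel m f) :=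
    fun s ↦ ⟨X _ _ _ s.2.2.2, s.1, g _ _ _ s.2.2.2, hg' _ _ _ s.2.2.2⟩
  let st (i : ℕ) : Σ' (x y : C) (f : x ⟶ y), HasPseudoNKernel m f :=
    Nat.rec ⟨x, y, f, hf⟩ (fun _ ↦ step) i
  exact ⟨{
    next i := (st (i + 1)).1
    map₁ := (st 1).2.2.1
    map i := (st (i + 2)).2.2.1
    exact₀ := hg _ _ _ (st 0).2.2.2
    exact₁ := hg _ _ _ (st 1).2.2.2
    exact_succ i := hg _ _ _ (st (i + 2)).2.2.2 }⟩

section Presentation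

/-! ### Presentations by representables -/

variable {x y : C} {F : RightMod C} (p : (yo C).obj y ⟶ F) [Epi p]
  (q : (yo C).obj x ⟶ kernel p) [Epi q] {f : x ⟶ y}

lemma isFP_iff_of_presentation [HasFiniteBiproducts C] (hf : q ≫ kernel.ι p = (yo C).map f) (m : ℕ) :
    IsFP (m + 1) F ↔ IsFPPred m (kernel ((yo C).map f)) := by
  have h₁ := ShortComplex.shortExact_kernel p
  have h₂ := ShortComplex.shortExact_kernel_of_fac q (kernel.ι p) hf
  exact ⟨fun h ↦ IsFP.isFPPred_of_shortExact h₂ (isFP_yo m x) (.of_shortExact₁ h₁ (isFP_yo m y) h),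
    fun h ↦ ⟨_, p, finGen_yo y, inferInstance, inferInstance,
      .of_shortExact₃ h₂ h (isFP_yo m x)⟩⟩

lemma hasProjectiveDimensionLT_iff_of_presentation (hf : q ≫ kernel.ι p = (yo C).map f) (d : ℕ) :
    HasProjectiveDimensionLT F (d + 3) ↔
      HasProjectiveDimensionLT (kernel ((yo C).map f)) (d + 1) :=
  ((ShortComplex.shortExact_kernel p).hasProjectiveDimensionLT_X₃_iff (d + 1)
    (inferInstanceAs (Projective ((yo C).obj y)))).trans
  ((ShortComplex.shortExact_kernel_of_fac q (kernel.ι p) hf).hasProjectiveDimensionLT_X₃_iff d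
    (inferInstanceAs (Projective ((yo C).obj x))))

lemma exists_presentation [HasFiniteBiproducts C] {m : ℕ} (hF : IsFP (m + 1) F) :
    ∃ (y x : C) (p : (yo C).obj y ⟶ F) (_ : Epi p) (q : (yo C).obj x ⟶ kernel p) (_ : Epi q)
      (f : x ⟶ y), q ≫ kernel.ι p = (yo C).map f := by
  obtain ⟨y, p, hp⟩ := hF.finGen.exists_epi
  have hk : IsFP m (kernel p) :=
    .of_shortExact₁ (ShortComplex.shortExact_kernel p) (isFP_yo m y) hF
  obtain ⟨x, q, hq⟩ := hk.finGen.exists_epi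
  exact ⟨y, x, p, hp, q, hq, (yo C).preimage (q ≫ kernel.ι p), by simp⟩

end Presentation

/-! ### Coherence and prolongation of pseudo kernels -/

variable [HasFiniteBiproducts C] {m : ℕ}

/-- The image of `yo f` is of type FP_m inside the coherent module `yo y`, hence of type FP_{m+1},
so the kernel is of type FP_m. -/
lemma IsRightCoherent.hasPseudoNKernel_succ (hC : IsRightCoherent C (m + 1)) {x y : C}
    (f : x ⟶ y) (hf : HasPseudoNKernel m f) : HasPseudoNKernel (m + 1) f := by
  rw [hasPseudoNKernel_iff] at hf ⊢
  let F := (yo C).map f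
  have hS := ShortComplex.shortExact_kernel_of_fac (Abelian.factorThruImage F) (Abelian.image.ι F)
    (Abelian.image.fac F)
  have h₁ : IsFP m (Abelian.image F) := .of_shortExact₃ hS hf (isFP_yo m x)
  have h₂ := (hC _ (isFP_yo (m + 1) y)).2 (Subobject.mk (Abelian.image.ι F))
    (h₁.of_iso (Subobject.underlyingIso _).symm)
  exact .of_shortExact₁ hS (isFP_yo m x) (h₂.of_iso (Subobject.underlyingIso _))

lemma isRightCoherent_of_hasPseudoNKernel_succ
    (H : ∀ (x y : C) (f : x ⟶ y), HasPseudoNKernel m f → HasPseudoNKernel (m + 1) f) :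
    IsRightCoherent C (m + 1) := by
  have H' (F : RightMod C) (hF : IsFP (m + 1) F) : IsFP (m + 2) F := by
    obtain ⟨y, x, p, _, q, _, f, hf⟩ := exists_presentation hF
    rw [isFP_iff_of_presentation p q hf] at hF ⊢
    rw [← hasPseudoNKernel_iff] at hF ⊢
    exact H _ _ _ hF
  refine fun F hF ↦ ⟨hF, fun S hS ↦ ?_⟩
  have hE : (ShortComplex.mk S.arrow (cokernel.π S.arrow) (cokernel.condition _)).ShortExact :=
    { exact := ShortComplex.exact_cokernel _ }
  -- The quotient by `S` is of type FP_{m+1}, hence FP_{m+2} by `H'`, which forces `S` to be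
  -- FP_{m+1}.
  exact .of_shortExact₁ hE hF (H' _ (.of_shortExact₃ hE hS hF))

end PseudoKer

/-- In (ii) the index is `k = j + 1 ≥ 1`, so that `α` is an endomorphism of `xₖ₋₁ = xⱼ`. -/
theorem mainTheorem5 (C : Type u) [SmallCategory C] [Preadditive C] [HasFiniteBiproducts C]
    (n : ℕ) (hn : 1 ≤ n) :
    PseudoKer.IsRightRegularCoherent C n ↔
      (∀ (x y : C) (f : x ⟶ y),
        PseudoKer.HasPseudoNKernel (n - 1) f → PseudoKer.HasPseudoNKernel n f) ∧
      (∀ (x y : C) (f : x ⟶ y) (K : PseudoKer.PseudoInftyKernel f),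
        ∃ (j : ℕ) (α : K.src j ⟶ K.src j),
          K.mor (j + 1) ≫ α = 0 ∧ α ≫ K.mor j = K.mor j) := by
  obtain ⟨m, rfl⟩ := Nat.exists_eq_add_of_le' hn
  rw [Nat.add_sub_cancel]
  constructor
  · rintro ⟨hC, hd⟩
    refine ⟨fun x y f ↦ hC.hasPseudoNKernel_succ f, fun x y f K ↦ ?_⟩
    rw [K.exists_endomorphism_iff]
    let F := (PseudoKer.yo C).map f
    -- The abelian image is by definition the kernel of `cokernel.π F`, so this presents the
    -- cokernel.
    have e : Abelian.factorThruImage F ≫ kernel.ι (cokernel.π F) = F := Abelian.image.fac F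
    obtain ⟨d, h⟩ := hd (cokernel F) ((PseudoKer.isFP_iff_of_presentation _ _ e m).2
      ((PseudoKer.hasPseudoNKernel_iff m f).1 (K.hasPseudoNKernel m 0)))
    exact ⟨d + 1, (PseudoKer.hasProjectiveDimensionLT_iff_of_presentation _ _ e d).1
      (hasProjectiveDimensionLT_of_ge _ (d + 1) _ (by lia))⟩
  · rintro ⟨H, hK⟩
    refine ⟨PseudoKer.isRightCoherent_of_hasPseudoNKernel_succ H, fun F hF ↦ ?_⟩
    obtain ⟨y, x, p, _, q, _, f, hf⟩ := PseudoKer.exists_presentation hF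
    rw [PseudoKer.isFP_iff_of_presentation p q hf, ← PseudoKer.hasPseudoNKernel_iff] at hF
    obtain ⟨K⟩ := PseudoKer.nonempty_pseudoInftyKernel H f hF
    obtain ⟨d, h⟩ := K.exists_endomorphism_iff.1 (hK x y f K)
    exact ⟨d + 2, (PseudoKer.hasProjectiveDimensionLT_iff_of_presentation p q hf d).2
      (hasProjectiveDimensionLT_of_ge _ d _ (by lia))⟩
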